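/- Call a set $C\subseteq\mathbb{R}^2$ a simple curve if $C=f([0,1])$ for some injective continuous $f:[0,1]\to\mathbb{R}^2$ (an injective parametrization of $C$). Its length is $$l(C)=\sup\sum_{i=0}^{n-1}|f(a_i)-f(a_{i+1})|\in[0,\infty],$$ the supremum being over all partitions $0=a_0<a_1<\dots<a_n=1$ and $|\cdot|$ the Euclidean norm; this does not depend on the choice of the injective parametrization $f$. The curve is rectifiable if $l(C)<\infty$. For $z=(a,b)\in\mathbb{R}^2$ and $\varepsilon>0$ let $V_\varepsilon(z)$ be the open square $\{(x,y): |x-a|<\varepsilon,\ |y-b|<\varepsilon\}$; it is called rational if $a,b,\varepsilon$ are rational. Let $V_\varepsilon(A)=\bigcup_{z\in A}V_\varepsilon(z)$ and $d_H(A,B)=\inf\{\varepsilon: A\subseteq V_\varepsilon(B)\text{ and }B\subseteq V_\varepsilon(A)\}$. A simple curve $C$ is $K$-computable if there is a computable sequence $(Q_n)_{n\in\mathbb{N}}$ of finite sets of rational neighborhoods such that, for all $n$, $$C\subseteq\bigcup Q_n\quad\text{and}\quad d_H\Bigl(\bigcup Q_n,\,C\Bigr)<2^{-n}.$$ A real number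 $x$ is left computable (c.e.) if there is an increasing (that is, non-decreasing) computable sequence of rational numbers that converges to $x$. **Theorem.** If $C$ is a rectifiable $K$-computable simple curve, then its length $l(C)$ is left computable. -/

import Mathlib

namespace CompCurve

open Set Filter Topology

/-- The Euclidean plane. -/
abbrev Plane : Type := EuclideanSpace ℝ (Fin 2)

/-! ### Simple curves and their length -/

/-- `f` restricted to `[0,1]` is an injective continuous parametrization of `C`; the values of
`f` outside `[0,1]` play no role. So `C` is a simple (open) plane curve, that is a Jordan arc,
exactly when some `f` has this property. -/
def IsInjParametrization (f : ℝ → Plane) (C : Set Plane) : Prop :=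
  ContinuousOn f (Icc 0 1) ∧ InjOn f (Icc 0 1) ∧ f '' Icc 0 1 = C

/-- The length of the parametrization `f` on `[0,1]`: the supremum, in `[0, ∞]`, of the Euclidean
lengths of the polygons inscribed along partitions of `[0,1]`. -/
noncomputable def length (f : ℝ → Plane) : ENNReal :=
  eVariationOn f (Icc 0 1)

/-! ### Square neighborhoods and the Hausdorff distance -/

/-- The `ε`-neighborhood `V_ε(z)`: the open square bounded by the lines `x = z₀ ± ε` and
`y = z₁ ± ε`. It is empty for `ε ≤ 0`. -/
def nbhd (ε : ℝ) (z : Plane) : Set Plane :=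
  {w | |w 0 - z 0| < ε ∧ |w 1 - z 1| < ε}

/-- The `ε`-neighborhood `V_ε(A)` of a set. -/
def nbhdSet (ε : ℝ) (A : Set Plane) : Set Plane :=
  ⋃ z ∈ A, nbhd ε z

/-- The Hausdorff distance built on the square neighborhoods. It is only applied to non-empty
bounded sets, where the infimum is over a non-empty set of positive numbers. -/
noncomputable def hausDist (A B : Set Plane) : ℝ :=
  sInf {ε : ℝ | A ⊆ nbhdSet ε B ∧ B ⊆ nbhdSet ε A}

/-! ### Computable sequences of rationals and of finite sets of rational neighborhoods -/

/-- The rational number `p / (q + 1)` with code `(p, q)`; every rational has a code. -/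
def ratOfCode (c : ℤ × ℕ) : ℚ :=
  (c.1 : ℚ) / ((c.2 : ℚ) + 1)

/-- A sequence of rationals is computable when its numerators and denominators can be produced by
a computable (total recursive) function. -/
def IsComputableRatSeq (x : ℕ → ℚ) : Prop :=
  ∃ c : ℕ → ℤ × ℕ, Computable c ∧ ∀ n, x n = ratOfCode (c n)

/-- Data `(a, b, ε)` of the rational neighborhood `V_ε(a, b)`. -/
abbrev RatNbhd : Type := ℚ × ℚ × ℚ

/-- The open square described by the data `(a, b, ε)`. -/
noncomputable def RatNbhd.toSet (V : RatNbhd) : Set Plane :=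
  nbhd (V.2.2 : ℝ) !₂[(V.1 : ℝ), (V.2.1 : ℝ)]

/-- The rational neighborhood given by codes of `a`, `b` and `ε`. -/
def ratNbhdOfCode (c : (ℤ × ℕ) × (ℤ × ℕ) × (ℤ × ℕ)) : RatNbhd :=
  (ratOfCode c.1, ratOfCode c.2.1, ratOfCode c.2.2)

/-- A sequence of finite sets of rational neighborhoods is computable when a computable (total
recursive) function maps `n` to a finite list of codes of the elements of the `n`-th set. -/
def IsComputableNbhdSeq (Q : ℕ → Finset RatNbhd) : Prop :=
  ∃ c : ℕ → List ((ℤ × ℕ) × (ℤ × ℕ) × (ℤ × ℕ)), Computable c ∧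
    ∀ n V, V ∈ Q n ↔ ∃ d ∈ c n, ratNbhdOfCode d = V

/-- The union `⋃ Q` of a finite set of rational neighborhoods. -/
noncomputable def union (Q : Finset RatNbhd) : Set Plane :=
  ⋃ V ∈ Q, RatNbhd.toSet V

/-! ### `K`-computable curves and left computable reals -/

/-- `K`-computability (of a simple curve `C`): there is a computable sequence of finite sets of
rational neighborhoods that cover `C` and approximate it within `2⁻ⁿ`. -/
def IsKComputable (C : Set Plane) : Prop :=
  ∃ Q : ℕ → Finset RatNbhd, IsComputableNbhdSeq Q ∧
    ∀ n : ℕ, C ⊆ union (Q n) ∧ hausDist (union (Q n)) C < ((2 : ℝ) ^ n)⁻¹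

/-- A real number is left computable (c.e.) when it is the limit of an increasing computable
sequence of rationals. -/
def IsLeftComputable (x : ℝ) : Prop :=
  ∃ q : ℕ → ℚ, IsComputableRatSeq q ∧ Monotone q ∧
    Tendsto (fun n => (q n : ℝ)) atTop (𝓝 x)

end CompCurve

namespace CompCurve

open Set Filter Topology

/-! ### Primitive recursive arithmetic on codes of rationals -/

/-! No parametrization of the curve is available to the algorithm, only covers of the point set `C`;
the order of points along the curve has to be recovered from the covers. This is done with finite
certificates. A certificate groups the squares of one cover into a chain, in which members whose
labels differ by at least 2 are disjoint, and attaches rational weights whose increments between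
selected members are bounded by the distances between these members.

Soundness (`Certificate.Valid.le_length`): a connected path from the first to the last member of
such a chain cannot skip a member, so it meets the members in order (`exists_monotone_mem_chain`).
The weight increments are then at most the sides of an inscribed polygon, and they telescope to a
lower bound for the length. The anchoring conditions ensure that `C` really meets both end members.

Completeness (`exists_valid_certificate`): for every nonnegative `a` below the length some
certificate proves a bound above `a`. Squares of a fine cover are labelled by rounded parameter
times of nearby points of `C`. Injectivity and compactness keep points with distant times apart, and
an arc has empty interior (`interior_arc_eq_empty`), so squares contained in a small neighborhood of
`C` are themselves small. The labels need not be computable, since it suffices that a certificate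
exists.

Validity is decidable given the covers, so the running maximum of the bounds of all valid
certificates is a computable nondecreasing rational sequence, and its limit is the length
(`isLeftComputable_of_certificates`). -/

theorem encode_int_ofNat (n : ℕ) : Encodable.encode (n : ℤ) = 2 * n := rfl

theorem encode_int_negSucc (n : ℕ) : Encodable.encode (Int.negSucc n) = 2 * n + 1 := rfl

/-- The parity of the code of an integer is its sign: `n` has code `2 * n` and `-(n + 1)` has code
`2 * n + 1`. -/
theorem primrec_int_toNat : Primrec Int.toNat := by
  refine (Primrec.ite (c := fun z : ℤ => Encodable.encode z % 2 = 0)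
    (f := fun z => Encodable.encode z / 2) (g := fun _ => 0) ?_ ?_ (Primrec.const 0)).of_eq ?_
  · exact Primrec.eq.comp (Primrec.nat_mod.comp Primrec.encode (Primrec.const 2)) (Primrec.const 0)
  · exact Primrec.nat_div.comp Primrec.encode (Primrec.const 2)
  · rintro (n | n)
    · simp [encode_int_ofNat]
    · rw [encode_int_negSucc, if_neg (by omega)]; rfl

theorem primrec_int_neg_toNat : Primrec fun z : ℤ => (-z).toNat := by
  refine (Primrec.ite (c := fun z : ℤ => Encodable.encode z % 2 = 0)
    (f := fun _ => 0) (g := fun z => Encodable.encode z / 2 + 1) ?_ (Primrec.const 0) ?_).of_eq ?_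
  · exact Primrec.eq.comp (Primrec.nat_mod.comp Primrec.encode (Primrec.const 2)) (Primrec.const 0)
  · exact Primrec.succ.comp (Primrec.nat_div.comp Primrec.encode (Primrec.const 2))
  · rintro (n | n)
    · simp [encode_int_ofNat]
    · rw [encode_int_negSucc, if_neg (by omega), Int.neg_negSucc]
      simp only [Int.toNat_natCast]
      omega

/-- The way back from naturals to integers: the integer operations below split their arguments into
positive and negative parts, compute in `ℕ`, and end with one such difference. -/
theorem primrec_natCast_sub : Primrec₂ fun u v : ℕ => (u : ℤ) - v := by
  refine Primrec₂.encode_iff.1 ?_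
  refine (Primrec.ite (c := fun p : ℕ × ℕ => p.2 ≤ p.1) (f := fun p => 2 * (p.1 - p.2))
    (g := fun p => 2 * (p.2 - p.1 - 1) + 1) ?_ ?_ ?_).of_eq ?_
  · exact Primrec.nat_le.comp Primrec.snd Primrec.fst
  · exact Primrec.nat_double.comp (Primrec.nat_sub.comp Primrec.fst Primrec.snd)
  · exact Primrec.nat_double_succ.comp
      (Primrec.pred.comp (g := fun p : ℕ × ℕ => p.2 - p.1)
        (Primrec.nat_sub.comp Primrec.snd Primrec.fst))
  · rintro ⟨u, v⟩
    by_cases h : v ≤ u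
    · simp only [if_pos h]
      rw [← encode_int_ofNat, Nat.cast_sub h]
    · simp only [if_neg h]
      rw [← encode_int_negSucc]
      congr 1
      omega

section Int

variable {α : Type*} [Primcodable α] {f g : α → ℤ}

theorem primrec_int_add (hf : Primrec f) (hg : Primrec g) : Primrec fun a => f a + g a := by
  refine (primrec_natCast_sub.comp
    (Primrec.nat_add.comp (primrec_int_toNat.comp hf) (primrec_int_toNat.comp hg))
    (Primrec.nat_add.comp (primrec_int_neg_toNat.comp hf) (primrec_int_neg_toNat.comp hg))).of_eq
    fun a => ?_
  push_cast
  omega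

theorem primrec_int_neg (hf : Primrec f) : Primrec fun a => -f a := by
  refine (primrec_natCast_sub.comp (primrec_int_neg_toNat.comp hf)
    (primrec_int_toNat.comp hf)).of_eq fun a => ?_
  omega

theorem primrec_int_mul (hf : Primrec f) (hg : Primrec g) : Primrec fun a => f a * g a := by
  refine (primrec_natCast_sub.comp
    (Primrec.nat_add.comp
      (Primrec.nat_mul.comp (primrec_int_toNat.comp hf) (primrec_int_toNat.comp hg))
      (Primrec.nat_mul.comp (primrec_int_neg_toNat.comp hf) (primrec_int_neg_toNat.comp hg)))
    (Primrec.nat_add.comp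
      (Primrec.nat_mul.comp (primrec_int_toNat.comp hf) (primrec_int_neg_toNat.comp hg))
      (Primrec.nat_mul.comp (primrec_int_neg_toNat.comp hf) (primrec_int_toNat.comp hg)))).of_eq
    fun a => ?_
  push_cast
  have h1 : ((f a).toNat : ℤ) - ((-f a).toNat : ℤ) = f a := by omega
  have h2 : ((g a).toNat : ℤ) - ((-g a).toNat : ℤ) = g a := by omega
  calc _ = (((f a).toNat : ℤ) - ((-f a).toNat : ℤ)) * (((g a).toNat : ℤ) - ((-g a).toNat : ℤ)) := by
        ring
    _ = _ := by rw [h1, h2]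

theorem primrec_int_le (hf : Primrec f) (hg : Primrec g) : PrimrecPred fun a => f a ≤ g a := by
  refine (Primrec.nat_le.comp
    (Primrec.nat_add.comp (primrec_int_toNat.comp hf) (primrec_int_neg_toNat.comp hg))
    (Primrec.nat_add.comp (primrec_int_toNat.comp hg) (primrec_int_neg_toNat.comp hf))).of_eq
    fun a => ?_
  omega

theorem primrec_natCast {f : α → ℕ} (hf : Primrec f) : Primrec fun a => (f a : ℤ) :=
  (primrec_natCast_sub.comp hf (Primrec.const 0)).of_eq fun a => by simp

end Int

/-- Codes `(p, q)` of rationals `p / (q + 1)`. -/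
abbrev Code : Type := ℤ × ℕ

/-- Addition on codes of rationals. -/
def Code.add (c d : Code) : Code :=
  (c.1 * (d.2 + 1 : ℕ) + d.1 * (c.2 + 1 : ℕ), (c.2 + 1) * (d.2 + 1) - 1)

/-- Subtraction on codes of rationals. -/
def Code.sub (c d : Code) : Code :=
  Code.add c (-d.1, d.2)

/-- Multiplication on codes of rationals. -/
def Code.mul (c d : Code) : Code :=
  (c.1 * d.1, (c.2 + 1) * (d.2 + 1) - 1)

theorem ratOfCode_add (c d : Code) : ratOfCode (c.add d) = ratOfCode c + ratOfCode d := by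
  -- Codes store the denominator minus one. The truncated subtraction is exact because the product
  -- of the denominators is positive.
  have h : (((c.2 + 1) * (d.2 + 1) - 1 : ℕ) : ℚ) = ((c.2 : ℚ) + 1) * (d.2 + 1) - 1 := by
    rw [Nat.cast_sub (Nat.mul_pos c.2.succ_pos d.2.succ_pos)]; push_cast; ring
  simp only [ratOfCode, Code.add, h]
  push_cast
  field_simp
  ring

theorem ratOfCode_sub (c d : Code) : ratOfCode (c.sub d) = ratOfCode c - ratOfCode d := by
  rw [Code.sub, ratOfCode_add, sub_eq_add_neg]
  congr 1
  simp only [ratOfCode]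
  push_cast
  ring

theorem ratOfCode_mul (c d : Code) : ratOfCode (c.mul d) = ratOfCode c * ratOfCode d := by
  have h : (((c.2 + 1) * (d.2 + 1) - 1 : ℕ) : ℚ) = ((c.2 : ℚ) + 1) * (d.2 + 1) - 1 := by
    rw [Nat.cast_sub (Nat.mul_pos c.2.succ_pos d.2.succ_pos)]; push_cast; ring
  simp only [ratOfCode, Code.mul, h]
  push_cast
  field_simp
  ring

theorem ratOfCode_le_iff (c d : Code) :
    ratOfCode c ≤ ratOfCode d ↔ c.1 * (d.2 + 1 : ℕ) ≤ d.1 * (c.2 + 1 : ℕ) := by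
  rw [ratOfCode, ratOfCode, div_le_div_iff₀ (by positivity) (by positivity)]
  exact_mod_cast Iff.rfl

theorem ratOfCode_surjective : Function.Surjective ratOfCode := by
  intro x
  refine ⟨(x.num, x.den - 1), ?_⟩
  have h : ((x.den - 1 : ℕ) : ℚ) + 1 = x.den := by
    exact_mod_cast Nat.sub_add_cancel x.pos
  simp only [ratOfCode, h, Rat.num_div_den]

section Code

variable {α : Type*} [Primcodable α] {f g : α → Code}

theorem primrec_code_add (hf : Primrec f) (hg : Primrec g) :
    Primrec fun a => Code.add (f a) (g a) := by
  have hf2 := Primrec.succ.comp (Primrec.snd.comp hf)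
  have hg2 := Primrec.succ.comp (Primrec.snd.comp hg)
  exact Primrec.pair
    (primrec_int_add (primrec_int_mul (Primrec.fst.comp hf) (primrec_natCast hg2))
      (primrec_int_mul (Primrec.fst.comp hg) (primrec_natCast hf2)))
    (Primrec.pred.comp (Primrec.nat_mul.comp hf2 hg2))

theorem primrec_code_sub (hf : Primrec f) (hg : Primrec g) :
    Primrec fun a => Code.sub (f a) (g a) :=
  primrec_code_add hf
    (Primrec.pair (primrec_int_neg (Primrec.fst.comp hg)) (Primrec.snd.comp hg))

theorem primrec_code_mul (hf : Primrec f) (hg : Primrec g) :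
    Primrec fun a => Code.mul (f a) (g a) := by
  have hf2 := Primrec.succ.comp (Primrec.snd.comp hf)
  have hg2 := Primrec.succ.comp (Primrec.snd.comp hg)
  exact Primrec.pair (primrec_int_mul (Primrec.fst.comp hf) (Primrec.fst.comp hg))
    (Primrec.pred.comp (Primrec.nat_mul.comp hf2 hg2))

theorem primrec_ratOfCode_le (hf : Primrec f) (hg : Primrec g) :
    PrimrecPred fun a => ratOfCode (f a) ≤ ratOfCode (g a) := by
  have hf2 := Primrec.succ.comp (Primrec.snd.comp hf)
  have hg2 := Primrec.succ.comp (Primrec.snd.comp hg)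
  refine (primrec_int_le (primrec_int_mul (Primrec.fst.comp hf) (primrec_natCast hg2))
    (primrec_int_mul (Primrec.fst.comp hg) (primrec_natCast hf2))).of_eq fun a => ?_
  exact (ratOfCode_le_iff _ _).symm

end Code

/-! ### Certificates for lower bounds of the length -/

/-- Codes `(a, b, ε)` of rational neighborhoods. -/
abbrev SquareCode : Type := Code × Code × Code

/-- A link of a chain: its label, its weight and a square. All squares that carry the same label
form one member of the chain. -/
abbrev Link : Type := ℕ × Code × SquareCode

/-- A certificate `((n, r, k), W, L)`: a chain `L` whose labels run from `0` to `r * k`, to be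
compared with the `n`-th cover of the curve, every `r`-th member of which is used for the lower
bound `W` of the length. -/
abbrev Certificate : Type := (ℕ × ℕ × ℕ) × Code × List Link

/-- A sufficient condition for two squares to be disjoint; it is also necessary when both are
non-empty. -/
def Apart (s t : SquareCode) : Prop :=
  ratOfCode s.2.2 + ratOfCode t.2.2 ≤ ratOfCode s.1 - ratOfCode t.1 ∨
  ratOfCode s.2.2 + ratOfCode t.2.2 ≤ ratOfCode t.1 - ratOfCode s.1 ∨
  ratOfCode s.2.2 + ratOfCode t.2.2 ≤ ratOfCode s.2.1 - ratOfCode t.2.1 ∨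
  ratOfCode s.2.2 + ratOfCode t.2.2 ≤ ratOfCode t.2.1 - ratOfCode s.2.1

/-- The excess of the difference of the weights of two links, enlarged by the sizes of the two
squares. -/
def linkGap (x y : Link) : ℚ :=
  ratOfCode y.2.1 - ratOfCode x.2.1 +
    2 * (ratOfCode x.2.2.2.2 + ratOfCode y.2.2.2.2)

/-- The squares of two links are at least as far from each other as their weights demand. -/
def WeightsSpaced (x y : Link) : Prop :=
  linkGap x y ≤ 0 ∨ linkGap x y * linkGap x y ≤
    (ratOfCode x.2.2.1 - ratOfCode y.2.2.1) * (ratOfCode x.2.2.1 - ratOfCode y.2.2.1) +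
    (ratOfCode x.2.2.2.1 - ratOfCode y.2.2.2.1) * (ratOfCode x.2.2.2.1 - ratOfCode y.2.2.2.1)

/-- Some square of the cover `S` has a center whose `1/(n+1)`-neighborhood avoids all links
with a label other than `l`. -/
def Anchored (S : List SquareCode) (n l : ℕ) (L : List Link) : Prop :=
  ∃ d ∈ S, ¬ ratOfCode d.2.2 ≤ 0 ∧ ∀ x ∈ L, x.1 = l ∨ Apart (d.1, d.2.1, (1, n)) x.2.2

/-- The conditions under which a certificate for the cover `S` is accepted. -/
def Certificate.Valid (S : List SquareCode) (z : Certificate) : Prop :=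
  (∀ d ∈ S, ratOfCode d.2.2 ≤ 0 ∨ ∃ x ∈ z.2.2, x.2.2 = d) ∧
  (∀ x ∈ z.2.2, ∀ y ∈ z.2.2, ¬ x.1 + 2 ≤ y.1 ∨ Apart x.2.2 y.2.2) ∧
  (∀ x ∈ z.2.2, ∀ y ∈ z.2.2,
    ¬ x.1 % z.1.2.1 = 0 ∨ ¬ y.1 = x.1 + z.1.2.1 ∨ WeightsSpaced x y) ∧
  Anchored S z.1.1 0 z.2.2 ∧
  Anchored S z.1.1 (z.1.2.1 * z.1.2.2) z.2.2 ∧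
  (∀ x ∈ z.2.2, ∀ y ∈ z.2.2, ¬ x.1 = 0 ∨ ¬ y.1 = z.1.2.1 * z.1.2.2 ∨
    ratOfCode z.2.1 ≤ ratOfCode y.2.1 - ratOfCode x.2.1)

section Primrec

variable {α β : Type*} [Primcodable α] [Primcodable β]

theorem primrecPred_forall_mem {f : α → List β} {R : β → α → Prop} (hf : Primrec f)
    (hR : PrimrecPred fun q : β × α => R q.1 q.2) : PrimrecPred fun a => ∀ b ∈ f a, R b a :=
  (PrimrecRel.forall_mem_list (R := R) hR).comp hf Primrec.id

theorem primrecPred_exists_mem {f : α → List β} {R : β → α → Prop} (hf : Primrec f)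
    (hR : PrimrecPred fun q : β × α => R q.1 q.2) : PrimrecPred fun a => ∃ b ∈ f a, R b a :=
  (PrimrecRel.exists_mem_list (R := R) hR).comp hf Primrec.id

theorem primrecPred_apart {f g : α → SquareCode} (hf : Primrec f) (hg : Primrec g) :
    PrimrecPred fun a => Apart (f a) (g a) := by
  have fa := Primrec.fst.comp hf
  have fb := Primrec.fst.comp (Primrec.snd.comp hf)
  have fe := Primrec.snd.comp (Primrec.snd.comp hf)
  have ga := Primrec.fst.comp hg
  have gb := Primrec.fst.comp (Primrec.snd.comp hg)
  have ge := Primrec.snd.comp (Primrec.snd.comp hg)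
  have he := primrec_code_add fe ge
  refine ((primrec_ratOfCode_le he (primrec_code_sub fa ga)).or
    ((primrec_ratOfCode_le he (primrec_code_sub ga fa)).or
    ((primrec_ratOfCode_le he (primrec_code_sub fb gb)).or
    (primrec_ratOfCode_le he (primrec_code_sub gb fb))))).of_eq fun a => ?_
  simp only [ratOfCode_add, ratOfCode_sub, Apart]

theorem primrecPred_weightsSpaced {f g : α → Link} (hf : Primrec f) (hg : Primrec g) :
    PrimrecPred fun a => WeightsSpaced (f a) (g a) := by
  have fw := Primrec.fst.comp (Primrec.snd.comp hf)
  have fs := Primrec.snd.comp (Primrec.snd.comp hf)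
  have gw := Primrec.fst.comp (Primrec.snd.comp hg)
  have gs := Primrec.snd.comp (Primrec.snd.comp hg)
  have fe := Primrec.snd.comp (Primrec.snd.comp fs)
  have ge := Primrec.snd.comp (Primrec.snd.comp gs)
  have ha := primrec_code_sub (Primrec.fst.comp fs) (Primrec.fst.comp gs)
  have hb := primrec_code_sub (Primrec.fst.comp (Primrec.snd.comp fs))
    (Primrec.fst.comp (Primrec.snd.comp gs))
  have hv := primrec_code_add (primrec_code_sub gw fw)
    (primrec_code_mul (Primrec.const ((2, 0) : Code)) (primrec_code_add fe ge))
  refine ((primrec_ratOfCode_le hv (Primrec.const ((0, 0) : Code))).or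
    (primrec_ratOfCode_le (primrec_code_mul hv hv)
      (primrec_code_add (primrec_code_mul ha ha) (primrec_code_mul hb hb)))).of_eq fun a => ?_
  have h0 : ratOfCode (0, 0) = 0 := by simp [ratOfCode]
  have h2 : ratOfCode (2, 0) = 2 := by simp [ratOfCode]
  simp only [ratOfCode_add, ratOfCode_sub, ratOfCode_mul, WeightsSpaced, linkGap, h0, h2]

theorem primrecPred_anchored {S : α → List SquareCode} {n l : α → ℕ} {L : α → List Link}
    (hS : Primrec S) (hn : Primrec n) (hl : Primrec l) (hL : Primrec L) :
    PrimrecPred fun a => Anchored (S a) (n a) (l a) (L a) := by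
  refine primrecPred_exists_mem
    (R := fun d a => ¬ ratOfCode d.2.2 ≤ 0 ∧
      ∀ x ∈ L a, x.1 = l a ∨ Apart (d.1, d.2.1, (1, n a)) x.2.2) hS ?_
  refine PrimrecPred.and (PrimrecPred.not ?_) ?_
  · have h0 : ratOfCode (0, 0) = 0 := by simp [ratOfCode]
    rw [← h0]
    exact primrec_ratOfCode_le (Primrec.snd.comp (Primrec.snd.comp Primrec.fst))
      (Primrec.const _)
  · refine primrecPred_forall_mem
      (R := fun x (q : SquareCode × α) => x.1 = l q.2 ∨
        Apart (q.1.1, q.1.2.1, (1, n q.2)) x.2.2) (hL.comp Primrec.snd) ?_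
    have hd : Primrec fun p : Link × SquareCode × α => p.2.1 := Primrec.fst.comp Primrec.snd
    have ha : Primrec fun p : Link × SquareCode × α => p.2.2 := Primrec.snd.comp Primrec.snd
    have hx : Primrec fun p : Link × SquareCode × α => p.1 := Primrec.fst
    refine PrimrecPred.or (Primrec.eq.comp (Primrec.fst.comp hx) (hl.comp ha)) ?_
    exact primrecPred_apart
      (Primrec.pair (Primrec.fst.comp hd) (Primrec.pair (Primrec.fst.comp (Primrec.snd.comp hd))
        (Primrec.pair (Primrec.const 1) (hn.comp ha))))
      (Primrec.snd.comp (Primrec.snd.comp hx))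

theorem primrecPred_pairs {L : α → List Link} {R : Link → Link → α → Prop} (hL : Primrec L)
    (hR : PrimrecPred fun p : Link × Link × α => R p.2.1 p.1 p.2.2) :
    PrimrecPred fun a => ∀ x ∈ L a, ∀ y ∈ L a, R x y a :=
  primrecPred_forall_mem (R := fun x a => ∀ y ∈ L a, R x y a) hL <|
    primrecPred_forall_mem (R := fun y (q : Link × α) => R q.1 y q.2) (hL.comp Primrec.snd) hR

end Primrec

/-- All quantifiers in `Certificate.Valid` are bounded by the two finite lists, its implications are
written as disjunctions, and its atoms compare naturals, rationals or codes. -/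
theorem primrecPred_certificate_valid :
    PrimrecPred fun q : List SquareCode × Certificate => Certificate.Valid q.1 q.2 := by
  have hS : Primrec fun q : List SquareCode × Certificate => q.1 := Primrec.fst
  have hp : Primrec fun q : List SquareCode × Certificate => q.2.1 :=
    Primrec.fst.comp Primrec.snd
  have hn := Primrec.fst.comp hp
  have hr := Primrec.fst.comp (Primrec.snd.comp hp)
  have hk := Primrec.snd.comp (Primrec.snd.comp hp)
  have hrk := Primrec.nat_mul.comp hr hk
  have hW : Primrec fun q : List SquareCode × Certificate => q.2.2.1 :=
    Primrec.fst.comp (Primrec.snd.comp Primrec.snd)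
  have hL : Primrec fun q : List SquareCode × Certificate => q.2.2.2 :=
    Primrec.snd.comp (Primrec.snd.comp Primrec.snd)
  have hx : Primrec fun p : Link × Link × (List SquareCode × Certificate) => p.2.1 :=
    Primrec.fst.comp Primrec.snd
  have hy : Primrec fun p : Link × Link × (List SquareCode × Certificate) => p.1 := Primrec.fst
  have hq : Primrec fun p : Link × Link × (List SquareCode × Certificate) => p.2.2 :=
    Primrec.snd.comp Primrec.snd
  have hxs := Primrec.snd.comp (Primrec.snd.comp hx)
  have hys := Primrec.snd.comp (Primrec.snd.comp hy)
  refine PrimrecPred.and ?_ (PrimrecPred.and ?_ (PrimrecPred.and ?_ (PrimrecPred.and ?_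
    (PrimrecPred.and ?_ ?_))))
  · refine primrecPred_forall_mem (R := fun d (q : List SquareCode × Certificate) =>
      ratOfCode d.2.2 ≤ 0 ∨ ∃ x ∈ q.2.2.2, x.2.2 = d) hS (PrimrecPred.or ?_ ?_)
    · have h0 : ratOfCode (0, 0) = 0 := by simp [ratOfCode]
      rw [← h0]
      exact primrec_ratOfCode_le (Primrec.snd.comp (Primrec.snd.comp Primrec.fst))
        (Primrec.const _)
    · refine primrecPred_exists_mem
        (R := fun x (p : SquareCode × List SquareCode × Certificate) => x.2.2 = p.1)
        (hL.comp Primrec.snd) ?_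
      exact Primrec.eq.comp (Primrec.snd.comp (Primrec.snd.comp Primrec.fst))
        (Primrec.fst.comp Primrec.snd)
  · exact primrecPred_pairs (R := fun x y _ => ¬ x.1 + 2 ≤ y.1 ∨ Apart x.2.2 y.2.2) hL
      (PrimrecPred.or (PrimrecPred.not (Primrec.nat_le.comp
        (Primrec.nat_add.comp (Primrec.fst.comp hx) (Primrec.const 2)) (Primrec.fst.comp hy)))
        (primrecPred_apart hxs hys))
  · exact primrecPred_pairs (R := fun x y (q : List SquareCode × Certificate) =>
      ¬ x.1 % q.2.1.2.1 = 0 ∨ ¬ y.1 = x.1 + q.2.1.2.1 ∨ WeightsSpaced x y) hL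
      (PrimrecPred.or (PrimrecPred.not (Primrec.eq.comp
        (Primrec.nat_mod.comp (Primrec.fst.comp hx) (hr.comp hq)) (Primrec.const 0)))
        (PrimrecPred.or (PrimrecPred.not (Primrec.eq.comp (Primrec.fst.comp hy)
          (Primrec.nat_add.comp (Primrec.fst.comp hx) (hr.comp hq))))
        (primrecPred_weightsSpaced hx hy)))
  · exact primrecPred_anchored hS hn (Primrec.const 0) hL
  · exact primrecPred_anchored hS hn hrk hL
  · refine primrecPred_pairs (R := fun x y (q : List SquareCode × Certificate) =>
      ¬ x.1 = 0 ∨ ¬ y.1 = q.2.1.2.1 * q.2.1.2.2 ∨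
        ratOfCode q.2.2.1 ≤ ratOfCode y.2.1 - ratOfCode x.2.1) hL
      (PrimrecPred.or (PrimrecPred.not (Primrec.eq.comp (Primrec.fst.comp hx) (Primrec.const 0)))
        (PrimrecPred.or (PrimrecPred.not (Primrec.eq.comp (Primrec.fst.comp hy) (hrk.comp hq)))
        ?_))
    refine (primrec_ratOfCode_le (hW.comp hq) (primrec_code_sub
      (Primrec.fst.comp (Primrec.snd.comp hy)) (Primrec.fst.comp (Primrec.snd.comp hx)))).of_eq
      fun p => ?_
    rw [ratOfCode_sub]

/-! ### The running maximum of the certified bounds -/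

open Classical in
/-- The bound of the certificate with number `N`, or a code of `0` when there is no such valid
certificate. -/
noncomputable def certifiedBound (c : ℕ → List SquareCode) (N : ℕ) : Code :=
  Option.casesOn (Encodable.decode (α := Certificate) N) (0, 0)
    fun z => if z.Valid (c z.1.1) then z.2.1 else (0, 0)

/-- The larger of two codes of rationals. -/
def Code.max (c d : Code) : Code :=
  if ratOfCode c ≤ ratOfCode d then d else c

theorem primrec_code_max : Primrec₂ Code.max :=
  Primrec.ite (primrec_ratOfCode_le Primrec.fst Primrec.snd) Primrec.snd Primrec.fst

theorem ratOfCode_max (c d : Code) :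
    ratOfCode (c.max d) = Max.max (ratOfCode c) (ratOfCode d) := by
  unfold Code.max
  split_ifs with h
  · exact (max_eq_right h).symm
  · exact (max_eq_left (not_le.1 h).le).symm

/-- The largest bound among the certificates with a number below `N`. -/
noncomputable def bestBound (c : ℕ → List SquareCode) (N : ℕ) : Code :=
  Nat.rec (0, 0) (fun n r => Code.max r (certifiedBound c n)) N

theorem computable_ite {α σ : Type*} [Primcodable α] [Primcodable σ] {p : α → Prop}
    [DecidablePred p] {f g : α → σ} (hp : Computable fun a => decide (p a)) (hf : Computable f)
    (hg : Computable g) : Computable fun a => if p a then f a else g a :=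
  (Computable.cond hp hf hg).of_eq fun a => by by_cases h : p a <;> simp [h]

/-- The cover sequence `c` is the only ingredient that is merely computable; the test applied to its
values is primitive recursive. -/
theorem computable_certifiedBound {c : ℕ → List SquareCode} (hc : Computable c) :
    Computable (certifiedBound c) := by
  classical
  have hz : Computable fun q : ℕ × Certificate => q.2 := Computable.snd
  refine Computable.option_casesOn (Computable.decode (α := Certificate)) (Computable.const _)
    (Computable₂.mk (computable_ite ?_
      (Computable.fst.comp (Computable.snd.comp hz)) (Computable.const _)))
  have hv : Primrec fun q : List SquareCode × Certificate => decide (q.2.Valid q.1) :=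
    primrecPred_certificate_valid.decide
  exact hv.to_comp.comp
    (Computable.pair (hc.comp (Computable.fst.comp (Computable.fst.comp hz))) hz)

theorem computable_bestBound {c : ℕ → List SquareCode} (hc : Computable c) :
    Computable (bestBound c) := by
  have hb := computable_certifiedBound hc
  unfold bestBound
  generalize certifiedBound c = b at hb
  exact Computable.nat_rec (f := fun N : ℕ => N) (g := fun _ => ((0, 0) : Code))
    (h := fun _ (q : ℕ × Code) => Code.max q.2 (b q.1)) Computable.id (Computable.const _)
    (primrec_code_max.to_comp.comp (Computable.snd.comp Computable.snd)
      (hb.comp (Computable.fst.comp Computable.snd)))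

theorem ratOfCode_bestBound_succ (c : ℕ → List SquareCode) (n : ℕ) :
    ratOfCode (bestBound c (n + 1)) =
      max (ratOfCode (bestBound c n)) (ratOfCode (certifiedBound c n)) :=
  ratOfCode_max _ _

theorem monotone_bestBound (c : ℕ → List SquareCode) :
    Monotone fun n => ratOfCode (bestBound c n) :=
  monotone_nat_of_le_succ fun n => by
    simpa only [ratOfCode_bestBound_succ] using le_max_left _ _

theorem certifiedBound_le_bestBound (c : ℕ → List SquareCode) (n : ℕ) :
    ratOfCode (certifiedBound c n) ≤ ratOfCode (bestBound c (n + 1)) := by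
  rw [ratOfCode_bestBound_succ]
  exact le_max_right _ _

/-- A real number is left computable when it is the supremum of `0` and of the bounds of the valid
certificates. -/
theorem isLeftComputable_of_certificates {c : ℕ → List SquareCode} (hc : Computable c) {x : ℝ}
    (h0 : 0 ≤ x)
    (hle : ∀ z : Certificate, z.Valid (c z.1.1) → (ratOfCode z.2.1 : ℝ) ≤ x)
    (hlt : ∀ a < x, 0 ≤ a → ∃ z : Certificate, z.Valid (c z.1.1) ∧ a < (ratOfCode z.2.1 : ℝ)) :
    IsLeftComputable x := by
  classical
  have hz0 : ((ratOfCode (0, 0) : ℚ) : ℝ) = 0 := by simp [ratOfCode]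
  have hcert : ∀ n, (ratOfCode (certifiedBound c n) : ℝ) ≤ x := by
    intro n
    unfold certifiedBound
    rcases Encodable.decode (α := Certificate) n with _ | z
    · simpa only [hz0] using h0
    · by_cases hv : z.Valid (c z.1.1)
      · simpa only [if_pos hv] using hle z hv
      · simpa only [if_neg hv, hz0] using h0
  have hbest : ∀ n, (ratOfCode (bestBound c n) : ℝ) ≤ x := by
    intro n
    induction n with
    | zero => exact hz0.le.trans h0
    | succ n ih =>
      rw [ratOfCode_bestBound_succ, Rat.cast_max]
      exact max_le ih (hcert n)
  have hmono : Monotone fun n => (ratOfCode (bestBound c n) : ℝ) :=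
    fun m n hmn => Rat.cast_le.2 (monotone_bestBound c hmn)
  refine ⟨fun n => ratOfCode (bestBound c n), ⟨_, computable_bestBound hc, fun n => rfl⟩,
    monotone_bestBound c, tendsto_atTop_isLUB hmono ⟨?_, fun b hb => ?_⟩⟩
  · rintro _ ⟨n, rfl⟩
    exact hbest n
  · by_contra! hbx
    -- The sequence starts at 0, so its upper bounds are nonnegative and certificates are needed
    -- only above nonnegative `a`.
    have hb0 : 0 ≤ b := hz0.ge.trans (hb ⟨0, rfl⟩)
    obtain ⟨z, hv, hz⟩ := hlt b hbx hb0
    have h1 : certifiedBound c (Encodable.encode z) = z.2.1 := by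
      simp only [certifiedBound, Encodable.encodek, if_pos hv]
    have h2 := certifiedBound_le_bestBound c (Encodable.encode z)
    rw [h1] at h2
    exact absurd (hb ⟨Encodable.encode z + 1, rfl⟩) (not_le.2 (hz.trans_le (Rat.cast_le.2 h2)))

/-! ### Squares in the plane -/

theorem dist_sq_eq (z w : Plane) : dist z w ^ 2 = (z 0 - w 0) ^ 2 + (z 1 - w 1) ^ 2 := by
  rw [EuclideanSpace.dist_eq, Real.sq_sqrt (by positivity)]
  simp [Fin.sum_univ_two, Real.dist_eq, sq_abs]

theorem abs_sub_le_dist (z w : Plane) : |z 0 - w 0| ≤ dist z w ∧ |z 1 - w 1| ≤ dist z w := by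
  have h := dist_sq_eq z w
  exact ⟨abs_le_of_sq_le_sq (by linarith [sq_nonneg (z 1 - w 1)]) dist_nonneg,
    abs_le_of_sq_le_sq (by linarith [sq_nonneg (z 0 - w 0)]) dist_nonneg⟩

theorem dist_le_abs_add_abs (z w : Plane) : dist z w ≤ |z 0 - w 0| + |z 1 - w 1| := by
  refine abs_le_of_sq_le_sq' ?_ (by positivity) |>.2
  rw [dist_sq_eq, ← sq_abs (z 0 - w 0), ← sq_abs (z 1 - w 1)]
  nlinarith [mul_nonneg (abs_nonneg (z 0 - w 0)) (abs_nonneg (z 1 - w 1))]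

theorem isOpen_nbhd (ε : ℝ) (z : Plane) : IsOpen (nbhd ε z) := by
  have h : ∀ i, Continuous fun w : Plane => |w i - z i| := fun i => by fun_prop
  exact (isOpen_lt (h 0) continuous_const).inter (isOpen_lt (h 1) continuous_const)

theorem nbhd_nonempty_pos {ε : ℝ} {z w : Plane} (h : w ∈ nbhd ε z) : 0 < ε :=
  (abs_nonneg _).trans_lt h.1

theorem self_mem_nbhd {ε : ℝ} (hε : 0 < ε) (z : Plane) : z ∈ nbhd ε z := by
  simp [nbhd, hε]

theorem mem_nbhd_comm {ε : ℝ} {z w : Plane} : w ∈ nbhd ε z ↔ z ∈ nbhd ε w := by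
  simp only [nbhd, mem_ofPred_eq, abs_sub_comm]

theorem dist_lt_of_mem_nbhd {ε : ℝ} {z w : Plane} (h : w ∈ nbhd ε z) : dist w z < 2 * ε := by
  have := dist_le_abs_add_abs w z
  linarith [h.1, h.2]

/-- The center of the square with the given code. -/
noncomputable def SquareCode.center (d : SquareCode) : Plane :=
  !₂[(ratOfCode d.1 : ℝ), (ratOfCode d.2.1 : ℝ)]

/-- Half of the side of the square with the given code. -/
noncomputable def SquareCode.radius (d : SquareCode) : ℝ :=
  (ratOfCode d.2.2 : ℝ)

/-- The open square with the given code. -/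
noncomputable def SquareCode.square (d : SquareCode) : Set Plane :=
  nbhd d.radius d.center

theorem SquareCode.center_zero (d : SquareCode) : d.center 0 = (ratOfCode d.1 : ℝ) := rfl

theorem SquareCode.center_one (d : SquareCode) : d.center 1 = (ratOfCode d.2.1 : ℝ) := rfl

theorem SquareCode.radius_pos_iff (d : SquareCode) : 0 < d.radius ↔ ¬ ratOfCode d.2.2 ≤ 0 := by
  rw [not_le, SquareCode.radius, Rat.cast_pos]

theorem radius_mk_one (a b : Code) (n : ℕ) :
    SquareCode.radius (a, b, ((1, n) : Code)) = 1 / ((n : ℝ) + 1) := by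
  simp [SquareCode.radius, ratOfCode]

theorem apart_iff (s t : SquareCode) : Apart s t ↔
    s.radius + t.radius ≤ |s.center 0 - t.center 0| ∨
    s.radius + t.radius ≤ |s.center 1 - t.center 1| := by
  simp only [Apart, SquareCode.center_zero, SquareCode.center_one, SquareCode.radius, le_abs,
    neg_sub, or_assoc]
  exact_mod_cast Iff.rfl

theorem Apart.disjoint {s t : SquareCode} (h : Apart s t) : Disjoint s.square t.square := by
  rw [Set.disjoint_left]
  intro w hs ht
  have tri : ∀ i, |s.center i - t.center i| ≤ |w i - s.center i| + |w i - t.center i| := by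
    intro i
    rw [abs_sub_comm (w i) (s.center i)]
    exact abs_sub_le _ _ _
  rcases (apart_iff s t).1 h with h | h
  · linarith [tri 0, hs.1, ht.1]
  · linarith [tri 1, hs.2, ht.2]

theorem linkGap_cast (x y : Link) : (linkGap x y : ℝ) =
    (ratOfCode y.2.1 : ℝ) - ratOfCode x.2.1 +
      2 * (SquareCode.radius x.2.2 + SquareCode.radius y.2.2) := by
  simp [linkGap, SquareCode.radius]

/-- A test on rationals must avoid the square root in the distance, so squares are compared; a
nonpositive gap is accepted outright. -/
theorem weightsSpaced_iff (x y : Link) : WeightsSpaced x y ↔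
    (linkGap x y : ℝ) ≤ dist (SquareCode.center x.2.2) (SquareCode.center y.2.2) := by
  have h : WeightsSpaced x y ↔ (linkGap x y : ℝ) ≤ 0 ∨ (linkGap x y : ℝ) * linkGap x y ≤
      dist (SquareCode.center x.2.2) (SquareCode.center y.2.2) ^ 2 := by
    rw [dist_sq_eq]
    simp only [WeightsSpaced, SquareCode.center_zero, SquareCode.center_one, sq]
    exact_mod_cast Iff.rfl
  rw [h, ← sq]
  constructor
  · rintro (h | h)
    · exact h.trans dist_nonneg
    · exact (abs_le_of_sq_le_sq' h dist_nonneg).2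
  · intro h
    rcases le_total (linkGap x y : ℝ) 0 with h0 | h0
    · exact Or.inl h0
    · exact Or.inr (pow_le_pow_left₀ h0 h 2)

/-- A point of a square is less than twice the half-side away from its center. The extra term in
`linkGap` pays for this at both ends. -/
theorem WeightsSpaced.sub_le_dist {x y : Link} (h : WeightsSpaced x y) {p q : Plane}
    (hp : p ∈ SquareCode.square x.2.2) (hq : q ∈ SquareCode.square y.2.2) :
    (ratOfCode y.2.1 : ℝ) - ratOfCode x.2.1 ≤ dist p q := by
  have h1 := (weightsSpaced_iff x y).1 h
  rw [linkGap_cast] at h1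
  have h2 := dist_lt_of_mem_nbhd hp
  have h3 := dist_lt_of_mem_nbhd hq
  have h4 := dist_triangle4 (SquareCode.center x.2.2) p q (SquareCode.center y.2.2)
  rw [dist_comm _ p] at h4
  linarith

/-! ### Covers by squares -/

/-- Points of a cover that is close to `C` are close to points of `C`. -/
theorem exists_mem_nbhd_of_hausDist_lt {A C : Set Plane} {δ : ℝ} (hA : Bornology.IsBounded A)
    (hC : Bornology.IsBounded C) (hA0 : A.Nonempty) (hC0 : C.Nonempty) (h : hausDist A C < δ)
    {z : Plane} (hz : z ∈ A) : ∃ w ∈ C, z ∈ nbhd δ w := by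
  -- On the empty set `sInf` takes the default value 0 and `h` would say nothing; boundedness
  -- excludes this.
  have hne : {ε : ℝ | A ⊆ nbhdSet ε C ∧ C ⊆ nbhdSet ε A}.Nonempty := by
    obtain ⟨r, hr⟩ := (Metric.isBounded_iff.1 (hA.union hC))
    have key : ∀ {X Y : Set Plane}, X ⊆ A ∪ C → Y ⊆ A ∪ C → Y.Nonempty →
        X ⊆ nbhdSet (r + 1) Y := by
      rintro X Y hX hY ⟨y, hy⟩ x hx
      refine mem_iUnion₂.2 ⟨y, hy, ?_⟩
      have h1 := hr (hX hx) (hY hy)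
      have h2 := abs_sub_le_dist x y
      exact ⟨by linarith [h2.1], by linarith [h2.2]⟩
    exact ⟨r + 1, key subset_union_left subset_union_right hC0,
      key subset_union_right subset_union_left hA0⟩
  obtain ⟨ε, hε, hlt⟩ := exists_lt_of_csInf_lt hne h
  obtain ⟨w, hw, hzw⟩ := mem_iUnion₂.1 (hε.1 hz)
  exact ⟨w, hw, hzw.1.trans hlt, hzw.2.trans hlt⟩

theorem isBounded_nbhd (ε : ℝ) (z : Plane) : Bornology.IsBounded (nbhd ε z) :=
  Metric.isBounded_ball.subset fun _ hw => Metric.mem_ball.2 (dist_lt_of_mem_nbhd hw)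

/-- The list `S` of squares covers `C`, and all points of these squares are within `δ` of `C`. -/
def ApproximatesWithin (C : Set Plane) (δ : ℝ) (S : List SquareCode) : Prop :=
  (∀ z ∈ C, ∃ d ∈ S, z ∈ SquareCode.square d) ∧
    ∀ d ∈ S, ∀ z ∈ SquareCode.square d, ∃ w ∈ C, z ∈ nbhd δ w

/-- The bound `2⁻ⁿ` is weakened to `1 / (n + 1)`, which has the simple code `(1, n)`. -/
theorem IsKComputable.exists_approximatesWithin {C : Set Plane} (hC : Bornology.IsBounded C)
    (hC0 : C.Nonempty) (h : IsKComputable C) : ∃ c : ℕ → List SquareCode, Computable c ∧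
      ∀ n : ℕ, ApproximatesWithin C (1 / ((n : ℝ) + 1)) (c n) := by
  obtain ⟨Q, ⟨c, hc, hQ⟩, hQC⟩ := h
  refine ⟨c, hc, fun n => ⟨fun z hz => ?_, fun d hd z hz => ?_⟩⟩
  · obtain ⟨V, hV, hzV⟩ := mem_iUnion₂.1 ((hQC n).1 hz)
    obtain ⟨d, hd, rfl⟩ := (hQ n V).1 hV
    exact ⟨d, hd, hzV⟩
  · have hz' : z ∈ union (Q n) := mem_iUnion₂.2 ⟨_, (hQ n _).2 ⟨d, hd, rfl⟩, hz⟩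
    have hb : Bornology.IsBounded (union (Q n)) :=
      (Bornology.isBounded_biUnion (Q n).finite_toSet).2 fun V _ => isBounded_nbhd _ _
    have hδ : ((2 : ℝ) ^ n)⁻¹ ≤ 1 / ((n : ℝ) + 1) := by
      rw [inv_eq_one_div]
      refine one_div_le_one_div_of_le (by positivity) ?_
      exact_mod_cast Nat.lt_two_pow_self
    exact exists_mem_nbhd_of_hausDist_lt hb hC ⟨z, hz'⟩ hC0 ((hQC n).2.trans_le hδ) hz'

/-! ### Chains -/

/-- A path from the first to the last member of a chain of open sets passes through all of its
members in their order. -/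
theorem exists_monotone_mem_chain {X : Type*} [TopologicalSpace X] {g : ℝ → X} {a b : ℝ}
    (hab : a ≤ b) (hg : ContinuousOn g (Icc a b)) {U : ℕ → Set X} (hU : ∀ i, IsOpen (U i))
    (hcov : ∀ t ∈ Icc a b, ∃ i, g t ∈ U i) (hdisj : ∀ i j, i + 2 ≤ j → Disjoint (U i) (U j))
    {m : ℕ} (ha : g a ∈ U 0) (hb : g b ∈ U m) :
    ∃ s : ℕ → ℝ, Monotone s ∧ (∀ i, s i ∈ Icc a b) ∧ ∀ i ≤ m, g (s i) ∈ U i := by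
  -- If the path avoided `U (i + 1)` after time `t`, the members up to `i` and those from `i + 2` on
  -- would be two disjoint open sets separating its remaining part: it starts in the former and ends
  -- in `U m`, which belongs to the latter.
  have step : ∀ i < m, ∀ t ∈ Icc a b, g t ∈ U i → ∃ t' ∈ Icc t b, g t' ∈ U (i + 1) := by
    intro i hi t ht hti
    by_contra! hno
    have hne : m ≠ i + 1 := by
      rintro rfl
      exact hno b (right_mem_Icc.2 ht.2) hb
    have hsub : Icc t b ⊆ Icc a b := Icc_subset_Icc_left ht.1
    have hpre : IsPreconnected (g '' Icc t b) :=
      isPreconnected_Icc.image g (hg.mono hsub)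
    obtain ⟨x, -, hx1, hx2⟩ := hpre (⋃ j ≤ i, U j) (⋃ j ≥ i + 2, U j)
      (isOpen_biUnion fun j _ => hU j) (isOpen_biUnion fun j _ => hU j)
      (by
        rintro _ ⟨u, hu, rfl⟩
        obtain ⟨j, hj⟩ := hcov u (hsub hu)
        rcases lt_trichotomy j (i + 1) with h | rfl | h
        · exact Or.inl (mem_iUnion₂.2 ⟨j, Nat.lt_succ_iff.1 h, hj⟩)
        · exact absurd hj (hno u hu)
        · exact Or.inr (mem_iUnion₂.2 ⟨j, h, hj⟩))
      ⟨g t, mem_image_of_mem g (left_mem_Icc.2 ht.2), mem_iUnion₂.2 ⟨i, le_rfl, hti⟩⟩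
      ⟨g b, mem_image_of_mem g (right_mem_Icc.2 ht.2), mem_iUnion₂.2 ⟨m, by omega, hb⟩⟩
    obtain ⟨j, hj, hxj⟩ := mem_iUnion₂.1 hx1
    obtain ⟨l, hl, hxl⟩ := mem_iUnion₂.1 hx2
    exact Set.disjoint_left.1 (hdisj j l (by omega)) hxj hxl
  -- A total version of `step`, with `t` itself as default, so that choice yields a function to
  -- iterate from `a`.
  have step' : ∀ i t, ∃ t', t ≤ t' ∧ (t ∈ Icc a b → t' ∈ Icc a b) ∧
      (i < m → t ∈ Icc a b → g t ∈ U i → g t' ∈ U (i + 1)) := by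
    intro i t
    by_cases h : i < m ∧ t ∈ Icc a b ∧ g t ∈ U i
    · obtain ⟨t', ht', hu⟩ := step i h.1 t h.2.1 h.2.2
      exact ⟨t', ht'.1, fun ht => ⟨ht.1.trans ht'.1, ht'.2⟩, fun _ _ _ => hu⟩
    · exact ⟨t, le_rfl, id, fun h1 h2 h3 => absurd ⟨h1, h2, h3⟩ h⟩
  choose F hF1 hF2 hF3 using step'
  let s : ℕ → ℝ := fun i => Nat.rec a F i
  have hs : ∀ i, s i ∈ Icc a b := by
    intro i
    induction i with
    | zero => exact left_mem_Icc.2 hab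
    | succ i ih => exact hF2 i _ ih
  refine ⟨s, monotone_nat_of_le_succ fun i => hF1 i _, hs, fun i => ?_⟩
  induction i with
  | zero => exact fun _ => ha
  | succ i ih => exact fun hi => hF3 i _ hi (hs i) (ih (by omega))

/-- The member of the chain `L` with label `i`. -/
def linkSet (L : List Link) (i : ℕ) : Set Plane :=
  ⋃ x ∈ {x : Link | x ∈ L ∧ x.1 = i}, SquareCode.square x.2.2

theorem mem_linkSet {L : List Link} {i : ℕ} {p : Plane} :
    p ∈ linkSet L i ↔ ∃ x ∈ L, x.1 = i ∧ p ∈ SquareCode.square x.2.2 := by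
  simp [linkSet, and_assoc]

theorem sum_dist_le_toReal_eVariationOn {X : Type*} [PseudoMetricSpace X] {g : ℝ → X}
    {s : Set ℝ} (h : eVariationOn g s ≠ ⊤) {u : ℕ → ℝ} (hu : Monotone u) (hus : ∀ i, u i ∈ s)
    (n : ℕ) : ∑ i ∈ Finset.range n, dist (g (u i)) (g (u (i + 1))) ≤ (eVariationOn g s).toReal := by
  have h1 := eVariationOn.sum_le (f := g) (n := n) hu hus
  have h2 := ENNReal.toReal_mono h h1
  rw [ENNReal.toReal_sum fun i _ => edist_ne_top _ _] at h2
  refine le_trans (le_of_eq ?_) h2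
  refine Finset.sum_congr rfl fun i _ => ?_
  rw [edist_comm, edist_dist, ENNReal.toReal_ofReal dist_nonneg]

namespace Certificate.Valid

variable {S : List SquareCode} {z : Certificate}

/-- The path visits the members labelled `0, r, 2r, …, r * k` at increasing times. Consecutive
visits are at least as far apart as the weights increase, and the increases telescope. -/
theorem le_of_path (hz : z.Valid S) {g : ℝ → Plane} {a b : ℝ} (hab : a ≤ b)
    (hg : ContinuousOn g (Icc a b)) (hfin : eVariationOn g (Icc a b) ≠ ⊤)
    (hcov : ∀ t ∈ Icc a b, ∃ d ∈ S, g t ∈ SquareCode.square d)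
    (ha : g a ∈ linkSet z.2.2 0) (hb : g b ∈ linkSet z.2.2 (z.1.2.1 * z.1.2.2)) :
    (ratOfCode z.2.1 : ℝ) ≤ (eVariationOn g (Icc a b)).toReal := by
  obtain ⟨⟨n, r, k⟩, W, L⟩ := z
  obtain ⟨h1, h2, h3, -, -, h6⟩ := hz
  simp only at *
  obtain ⟨s, hs, hsI, hsU⟩ := exists_monotone_mem_chain hab hg (U := linkSet L)
    (fun i => isOpen_biUnion fun x _ => isOpen_nbhd _ _)
    (by
      intro t ht
      obtain ⟨d, hd, htd⟩ := hcov t ht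
      rcases h1 d hd with h | ⟨x, hx, rfl⟩
      · exact absurd h ((SquareCode.radius_pos_iff d).1 (nbhd_nonempty_pos htd))
      · exact ⟨x.1, mem_linkSet.2 ⟨x, hx, rfl, htd⟩⟩)
    (by
      intro i j hij
      rw [Set.disjoint_left]
      intro p hi hj
      obtain ⟨x, hx, rfl, hpx⟩ := mem_linkSet.1 hi
      obtain ⟨y, hy, rfl, hpy⟩ := mem_linkSet.1 hj
      exact Set.disjoint_left.1 ((h2 x hx y hy).resolve_left (not_not.2 hij)).disjoint hpx hpy)
    ha hb
  have hle : ∀ j ≤ k, r * j ≤ r * k := fun j hj => Nat.mul_le_mul_left r hj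
  have hx : ∀ j, ∃ x : Link, j ≤ k → x ∈ L ∧ x.1 = r * j ∧
      g (s (r * j)) ∈ SquareCode.square x.2.2 := by
    intro j
    by_cases hj : j ≤ k
    · obtain ⟨x, hx⟩ := mem_linkSet.1 (hsU (r * j) (hle j hj))
      exact ⟨x, fun _ => hx⟩
    · exact ⟨(0, (0, 0), (0, 0), (0, 0), (0, 0)), fun h => absurd h hj⟩
  choose x hx using hx
  have hmono : Monotone fun j => s (r * j) := fun i j hij => hs (Nat.mul_le_mul_left r hij)
  refine le_trans ?_ (sum_dist_le_toReal_eVariationOn hfin hmono (fun j => hsI _) k)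
  have hsum := Finset.sum_range_sub (fun j => (ratOfCode (x j).2.1 : ℝ)) k
  have hW := ((h6 _ (hx 0 k.zero_le).1 _ (hx k le_rfl).1).resolve_left
    (not_not.2 (hx 0 k.zero_le).2.1)).resolve_left (not_not.2 (hx k le_rfl).2.1)
  have hW' : (ratOfCode W : ℝ) ≤ ratOfCode (x k).2.1 - ratOfCode (x 0).2.1 := by
    exact_mod_cast hW
  refine hW'.trans (hsum.symm.le.trans (Finset.sum_le_sum fun j hj => ?_))
  have hj' : j + 1 ≤ k := Finset.mem_range.1 hj
  obtain ⟨hx1, hx2, hx3⟩ := hx j (by omega)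
  obtain ⟨hy1, hy2, hy3⟩ := hx (j + 1) hj'
  refine WeightsSpaced.sub_le_dist (((h3 _ hx1 _ hy1).resolve_left ?_).resolve_left ?_) hx3 hy3
  · rw [hx2, Nat.mul_mod_right]; exact not_not.2 rfl
  · rw [hx2, hy2]; exact not_not.2 (by ring)

/-- The center of the anchoring square is within `1 / (n + 1)` of some `w` in `C`. A cover square
containing `w` meets the small square around that center, so it is not apart from it and must carry
the label `l`. -/
theorem exists_mem_linkSet_of_anchored (hz : z.Valid S) {C : Set Plane}
    (hS : ApproximatesWithin C (1 / ((z.1.1 : ℝ) + 1)) S) {l : ℕ}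
    (h : Anchored S z.1.1 l z.2.2) : ∃ p ∈ C, p ∈ linkSet z.2.2 l := by
  obtain ⟨d, hd, hpos, hap⟩ := h
  obtain ⟨w, hw, hdw⟩ := hS.2 d hd d.center
    (self_mem_nbhd ((SquareCode.radius_pos_iff d).2 hpos) _)
  obtain ⟨d', hd', hwd'⟩ := hS.1 w hw
  rcases hz.1 d' hd' with h | ⟨x, hx, rfl⟩
  · exact absurd h ((SquareCode.radius_pos_iff d').1 (nbhd_nonempty_pos hwd'))
  · refine ⟨w, hw, mem_linkSet.2 ⟨x, hx, (hap x hx).resolve_right fun hA => ?_, hwd'⟩⟩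
    refine Set.disjoint_left.1 hA.disjoint ?_ hwd'
    rw [SquareCode.square, radius_mk_one]
    exact mem_nbhd_comm.1 hdw

/-- The bound of a valid certificate is a lower bound for the length. -/
theorem le_length (hz : z.Valid S) {f : ℝ → Plane} {C : Set Plane}
    (hf : IsInjParametrization f C) (hrect : length f < ⊤)
    (hS : ApproximatesWithin C (1 / ((z.1.1 : ℝ) + 1)) S) :
    (ratOfCode z.2.1 : ℝ) ≤ (length f).toReal := by
  obtain ⟨hcont, -, himg⟩ := hf
  obtain ⟨p, hp, hpL⟩ := hz.exists_mem_linkSet_of_anchored hS hz.2.2.2.1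
  obtain ⟨q, hq, hqL⟩ := hz.exists_mem_linkSet_of_anchored hS hz.2.2.2.2.1
  rw [← himg] at hp hq
  obtain ⟨s, hs, rfl⟩ := hp
  obtain ⟨t, ht, rfl⟩ := hq
  have hcov : ∀ u ∈ Icc (0 : ℝ) 1, ∃ d ∈ S, f u ∈ SquareCode.square d :=
    fun u hu => hS.1 _ (himg ▸ mem_image_of_mem f hu)
  -- A certificate does not fix the orientation. If the curve meets the last member first, the
  -- time-reversed path is used.
  rcases le_total s t with hst | hts
  · have hsub : Icc s t ⊆ Icc 0 1 := Icc_subset_Icc hs.1 ht.2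
    have hle : eVariationOn f (Icc s t) ≤ length f := eVariationOn.mono f hsub
    exact (hz.le_of_path hst (hcont.mono hsub) (hle.trans_lt hrect).ne
      (fun u hu => hcov u (hsub hu)) hpL hqL).trans (ENNReal.toReal_mono hrect.ne hle)
  · have hmaps : MapsTo (fun u : ℝ => -u) (Icc (-s) (-t)) (Icc 0 1) := by
      intro u hu
      exact ⟨by linarith [hu.2, ht.1], by linarith [hu.1, hs.2]⟩
    have hle : eVariationOn (f ∘ fun u => -u) (Icc (-s) (-t)) ≤ length f :=
      eVariationOn.comp_le_of_antitoneOn f _ (fun _ _ _ _ h => neg_le_neg h) hmaps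
    exact (hz.le_of_path (neg_le_neg hts) (hcont.comp continuous_neg.continuousOn hmaps)
      (hle.trans_lt hrect).ne (fun u hu => hcov _ (hmaps hu)) (by simpa using hpL)
      (by simpa using hqL)).trans (ENNReal.toReal_mono hrect.ne hle)

end Certificate.Valid

/-! ### An arc has empty interior -/

/-- By compactness `f` is an embedding of `[0,1]`, so the preimage of `B` is preconnected, hence
contains every time between two of its own. -/
theorem apply_mem_of_isPreconnected_of_mem_Icc {X : Type*} [TopologicalSpace X] [T2Space X] {f : ℝ → X}
    (hf : ContinuousOn f (Icc 0 1)) (hinj : InjOn f (Icc 0 1)) {B : Set X} (hB : IsPreconnected B)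
    (hBC : B ⊆ f '' Icc 0 1) {s t u : ℝ} (hs : s ∈ Icc (0 : ℝ) 1) (ht : t ∈ Icc (0 : ℝ) 1)
    (hfs : f s ∈ B) (hft : f t ∈ B) (hsu : s ≤ u) (hut : u ≤ t) : f u ∈ B := by
  have hemb : IsClosedEmbedding ((Icc (0 : ℝ) 1).domRestrict f) :=
    (continuousOn_iff_continuous_domRestrict.1 hf).isClosedEmbedding hinj.injective
  have himg : (Icc (0 : ℝ) 1).domRestrict f '' ((Icc (0 : ℝ) 1).domRestrict f ⁻¹' B) = B := by
    rw [image_preimage_eq_iff, range_domRestrict]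
    exact hBC
  have hpre : IsPreconnected ((Icc (0 : ℝ) 1).domRestrict f ⁻¹' B) :=
    hemb.isInducing.isPreconnected_image.1 (himg.symm ▸ hB)
  have hord := hpre.ordConnected
  exact hord.out (x := ⟨s, hs⟩) (y := ⟨t, ht⟩) hfs hft
    (⟨hsu, hut⟩ : (⟨u, hs.1.trans hsu, hut.trans ht.2⟩ : Icc (0 : ℝ) 1) ∈ Icc _ _)

/-- If the arc contained a disc, it would contain a triangle. The subarc between two vertices lies
in the segment joining them, so the vertex whose time is in the middle would lie on the opposite
side. -/
theorem interior_arc_eq_empty {f : ℝ → Plane} (hf : ContinuousOn f (Icc 0 1))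
    (hinj : InjOn f (Icc 0 1)) : interior (f '' Icc 0 1) = ∅ := by
  by_contra hne
  obtain ⟨p, hp⟩ := nonempty_iff_ne_empty.2 hne
  obtain ⟨r, hr, hball⟩ := Metric.isOpen_iff.1 isOpen_interior p hp
  have hsub : Metric.ball p r ⊆ f '' Icc 0 1 := hball.trans interior_subset
  have hseg : ∀ {s t u : ℝ}, s ∈ Icc (0 : ℝ) 1 → t ∈ Icc (0 : ℝ) 1 → f s ∈ Metric.ball p r →
      f t ∈ Metric.ball p r → s ≤ u → u ≤ t → f u ∈ segment ℝ (f s) (f t) :=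
    fun hs ht hfs hft hsu hut => apply_mem_of_isPreconnected_of_mem_Icc hf hinj
      (convex_segment _ _).isPreconnected
      (((convex_ball p r).segment_subset hfs hft).trans hsub) hs ht
      (left_mem_segment _ _ _) (right_mem_segment _ _ _) hsu hut
  have hmem : ∀ x y : ℝ, |x| + |y| < r → (!₂[p 0 + x, p 1 + y] : Plane) ∈ Metric.ball p r := by
    intro x y h
    refine Metric.mem_ball.2 ((dist_le_abs_add_abs _ _).trans_lt ?_)
    simpa using h
  have hr2 : |r / 2| = r / 2 := abs_of_pos (by positivity)
  have h0 := hmem 0 0 (by simpa using hr)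
  have h1 := hmem (r / 2) 0 (by simp only [hr2, abs_zero]; linarith)
  have h2 := hmem 0 (r / 2) (by simp only [hr2, abs_zero]; linarith)
  obtain ⟨t0, ht0, e0⟩ := hsub h0
  obtain ⟨t1, ht1, e1⟩ := hsub h1
  obtain ⟨t2, ht2, e2⟩ := hsub h2
  -- No vertex is on the opposite side: the functionals `x + y`, `x` and `y` are each constant on
  -- one side and take another value at the remaining vertex.
  have n0 : f t0 ∉ segment ℝ (f t1) (f t2) ∧ f t0 ∉ segment ℝ (f t2) (f t1) := by
    rw [segment_symm ℝ (f t2), and_self]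
    rintro ⟨a, b, -, -, hab, h⟩
    have hx := congrArg (fun w : Plane => w 0 + w 1) h
    simp [e0, e1, e2] at hx
    obtain rfl : b = 1 - a := by linarith
    linarith
  have n1 : f t1 ∉ segment ℝ (f t0) (f t2) ∧ f t1 ∉ segment ℝ (f t2) (f t0) := by
    rw [segment_symm ℝ (f t2), and_self]
    rintro ⟨a, b, -, -, hab, h⟩
    have hx := congrArg (fun w : Plane => w 0) h
    simp [e0, e1, e2] at hx
    obtain rfl : b = 1 - a := by linarith
    linarith
  have n2 : f t2 ∉ segment ℝ (f t0) (f t1) ∧ f t2 ∉ segment ℝ (f t1) (f t0) := by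
    rw [segment_symm ℝ (f t1), and_self]
    rintro ⟨a, b, -, -, hab, h⟩
    have hx := congrArg (fun w : Plane => w 1) h
    simp [e0, e1, e2] at hx
    obtain rfl : b = 1 - a := by linarith
    linarith
  rw [← e0] at h0
  rw [← e1] at h1
  rw [← e2] at h2
  rcases le_total t0 t1 with h01 | h01 <;> rcases le_total t1 t2 with h12 | h12 <;>
    rcases le_total t0 t2 with h02 | h02
  · exact n1.1 (hseg ht0 ht2 h0 h2 h01 h12)
  · exact n1.1 (hseg ht0 ht2 h0 h2 h01 h12)
  · exact n2.1 (hseg ht0 ht1 h0 h1 h02 h12)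
  · exact n0.2 (hseg ht2 ht1 h2 h1 h02 h01)
  · exact n0.1 (hseg ht1 ht2 h1 h2 h01 h02)
  · exact n2.2 (hseg ht1 ht0 h1 h0 h12 h02)
  · exact n1.2 (hseg ht2 ht0 h2 h0 h12 h01)
  · exact n1.2 (hseg ht2 ht0 h2 h0 h12 h01)

/-- A square of a given size is not contained in arbitrarily small neighborhoods of a compact set
with empty interior. -/
theorem exists_pos_forall_square_not_near {C : Set Plane} (hC : IsCompact C)
    (hint : interior C = ∅) {ε : ℝ} (hε : 0 < ε) :
    ∃ δ > 0, ∀ z, ¬ ∀ w ∈ nbhd ε z, ∃ p ∈ C, w ∈ nbhd δ p := by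
  by_contra! hcon
  choose z hz using fun n : ℕ => hcon (1 / ((n : ℝ) + 1)) (by positivity)
  have hbdd : Bornology.IsBounded (Metric.thickening 2 C) := hC.isBounded.thickening
  have hzmem : ∀ n, z n ∈ Metric.thickening 2 C := by
    intro n
    obtain ⟨p, hp, h⟩ := hz n (z n) (self_mem_nbhd hε _)
    refine Metric.mem_thickening_iff.2 ⟨p, hp, (dist_lt_of_mem_nbhd h).trans_le ?_⟩
    have : 1 / ((n : ℝ) + 1) ≤ 1 := by
      rw [div_le_one (by positivity)]
      linarith [(Nat.cast_nonneg n : (0 : ℝ) ≤ n)]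
    linarith
  obtain ⟨y, -, φ, hφ, hy⟩ := tendsto_subseq_of_bounded hbdd hzmem
  -- Once the centers are within `ε / 2` of their limit `y`, this square lies in all of the given
  -- squares, so its points have distance 0 from the closed set `C`.
  have hsub : nbhd (ε / 2) y ⊆ C := by
    intro w hw
    rw [← hC.isClosed.closure_eq, Metric.mem_closure_iff]
    intro η hη
    have h1 : ∀ᶠ n in atTop, dist (z (φ n)) y < ε / 2 :=
      (Metric.tendsto_nhds.1 hy) _ (by positivity)
    have h2 : ∀ᶠ n in atTop, 1 / ((φ n : ℝ) + 1) < η / 2 :=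
      (tendsto_one_div_add_atTop_nhds_zero_nat.comp hφ.tendsto_atTop).eventually
        (gt_mem_nhds (by positivity))
    obtain ⟨n, hn1, hn2⟩ := (h1.and h2).exists
    have h3 := abs_sub_le_dist y (z (φ n))
    rw [dist_comm] at h3
    obtain ⟨p, hp, hwp⟩ := hz (φ n) w
      ⟨(abs_sub_le _ (y 0) _).trans_lt (by linarith [hw.1, h3.1]),
        (abs_sub_le _ (y 1) _).trans_lt (by linarith [hw.2, h3.2])⟩
    exact ⟨p, hp, (dist_lt_of_mem_nbhd hwp).trans (by linarith)⟩
  have hyint : y ∈ interior C :=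
    interior_maximal hsub (isOpen_nbhd _ _) (self_mem_nbhd (by positivity) _)
  rw [hint] at hyint
  exact hyint

/-! ### Inscribed polygons with vertices at equidistant times -/

/-- Leaving out vertices does not lengthen a polygon. -/
theorem sum_dist_monotone_le_sum_range {X : Type*} [PseudoMetricSpace X] (h : ℕ → X) {m : ℕ → ℕ}
    (hm : Monotone m) (n : ℕ) : ∑ i ∈ Finset.range n, dist (h (m i)) (h (m (i + 1))) ≤
      ∑ l ∈ Finset.range (m n), dist (h l) (h (l + 1)) := by
  induction n with
  | zero => simpa using Finset.sum_nonneg fun _ _ => dist_nonneg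
  | succ n ih =>
    rw [Finset.sum_range_succ, ← Finset.sum_range_add_sum_Ico _ (hm n.le_succ)]
    exact add_le_add ih (dist_le_Ico_sum_dist h (hm n.le_succ))

/-- Round the times of a good partition down to multiples of `1 / K`. By continuity the lengths
converge as `K` grows, and using all multiples as vertices can only increase them. -/
theorem exists_lt_sum_dist_equidistant {X : Type*} [PseudoMetricSpace X] {f : ℝ → X}
    (hf : ContinuousOn f (Icc 0 1)) {a : ℝ} (ha0 : 0 ≤ a)
    (ha : a < (eVariationOn f (Icc 0 1)).toReal) : ∃ K : ℕ, 0 < K ∧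
      a < ∑ i ∈ Finset.range K, dist (f (i / K)) (f ((i + 1 : ℕ) / K)) := by
  have ha' : ENNReal.ofReal a < eVariationOn f (Icc 0 1) :=
    (ENNReal.ofReal_lt_ofReal_iff_of_nonneg ha0).2 ha |>.trans_le ENNReal.ofReal_toReal_le
  obtain ⟨⟨n, u, hu, huI⟩, hlt⟩ := lt_iSup_iff.1 ha'
  simp only at hlt
  have hlt' : a < ∑ i ∈ Finset.range n, dist (f (u i)) (f (u (i + 1))) := by
    simp only [edist_dist] at hlt
    rw [← ENNReal.ofReal_sum_of_nonneg fun _ _ => dist_nonneg] at hlt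
    simpa only [dist_comm] using (ENNReal.ofReal_lt_ofReal_iff_of_nonneg ha0).1 hlt
  have hmem : ∀ (K : ℕ) (i : ℕ), 0 < K → ((⌊u i * K⌋₊ : ℕ) : ℝ) / K ∈ Icc (0 : ℝ) 1 := by
    intro K i hK
    have hK' : (0 : ℝ) < K := Nat.cast_pos.2 hK
    refine ⟨by positivity, (div_le_one hK').2 ((Nat.floor_le ?_).trans ?_)⟩
    · exact mul_nonneg (huI i).1 hK'.le
    · exact mul_le_of_le_one_left hK'.le (huI i).2
  have hlim : ∀ i, Tendsto (fun K : ℕ => f ((⌊u i * K⌋₊ : ℕ) / K)) atTop (𝓝 (f (u i))) := by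
    intro i
    refine (hf (u i) (huI i)).tendsto.comp (tendsto_nhdsWithin_iff.2 ⟨?_, ?_⟩)
    · exact (tendsto_nat_floor_mul_div_atTop (huI i).1).comp tendsto_natCast_atTop_atTop
    · filter_upwards [eventually_gt_atTop 0] with K hK using hmem K i hK
  have hsum := tendsto_finsetSum (Finset.range n) fun i _ => (hlim i).dist (hlim (i + 1))
  obtain ⟨K, hK1, hK⟩ := ((hsum.eventually (lt_mem_nhds hlt')).and (eventually_gt_atTop 0)).exists
  refine ⟨K, hK, hK1.trans_le ?_⟩
  have hm : Monotone fun i => ⌊u i * K⌋₊ := fun i j hij =>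
    Nat.floor_mono (mul_le_mul_of_nonneg_right (hu hij) K.cast_nonneg)
  refine (sum_dist_monotone_le_sum_range (fun l : ℕ => f (l / K)) hm n).trans ?_
  refine Finset.sum_le_sum_of_subset_of_nonneg (Finset.range_subset_range.2 ?_)
    fun _ _ _ => dist_nonneg
  have h := (hmem K n hK).2
  rw [div_le_one (Nat.cast_pos.2 hK)] at h
  exact_mod_cast h

/-- Pairs of times at least `σ` apart form a compact set, on which the distance of the images is
continuous and, by injectivity, positive. -/
theorem exists_pos_le_dist_of_injOn {X : Type*} [MetricSpace X] {f : ℝ → X}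
    (hf : ContinuousOn f (Icc 0 1)) (hinj : InjOn f (Icc 0 1)) {σ : ℝ} (hσ : 0 < σ) :
    ∃ κ > 0, ∀ s ∈ Icc (0 : ℝ) 1, ∀ t ∈ Icc (0 : ℝ) 1, σ ≤ |s - t| → κ ≤ dist (f s) (f t) := by
  let A : Set (ℝ × ℝ) := Icc 0 1 ×ˢ Icc 0 1 ∩ {q | σ ≤ |q.1 - q.2|}
  have hA : IsCompact A := (isCompact_Icc.prod isCompact_Icc).inter_right
    (isClosed_le continuous_const (by fun_prop))
  rcases A.eq_empty_or_nonempty with h | h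
  · refine ⟨1, one_pos, fun s hs t ht hst => ?_⟩
    exact absurd (show (s, t) ∈ A from ⟨⟨hs, ht⟩, hst⟩) (h ▸ notMem_empty _)
  · have hcont : ContinuousOn (fun q : ℝ × ℝ => dist (f q.1) (f q.2)) A :=
      continuous_dist.comp_continuousOn <|
        (hf.comp (s := A) continuousOn_fst fun q hq => hq.1.1).prodMk
          (hf.comp (s := A) continuousOn_snd fun q hq => hq.1.2)
    obtain ⟨q, hq, hmin⟩ := hA.exists_isMinOn h hcont
    refine ⟨_, dist_pos.2 fun heq => ?_, fun s hs t ht hst =>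
      hmin (show (s, t) ∈ A from ⟨⟨hs, ht⟩, hst⟩)⟩
    have h1 := hq.2
    rw [mem_ofPred_eq, hinj hq.1.1 hq.1.2 heq, sub_self, abs_zero] at h1
    linarith

/-! ### Existence of certificates -/

/-- The centers are at least `12 * ε` apart, while two squares that are not apart would have centers
at distance below `4 * ε`. -/
theorem apart_of_le_dist {s t : SquareCode} {ε : ℝ} {p q : Plane} (hs : s.radius ≤ ε)
    (ht : t.radius ≤ ε) (hp : dist s.center p ≤ 2 * ε) (hq : dist t.center q ≤ 2 * ε)
    (hpq : 16 * ε ≤ dist p q) (hε : 0 ≤ ε) : Apart s t := by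
  have h1 := dist_triangle4 p s.center t.center q
  have h2 := dist_le_abs_add_abs s.center t.center
  rw [dist_comm p s.center] at h1
  rw [apart_iff]
  by_contra! h
  linarith [h.1, h.2]

theorem exists_valid_certificate {f : ℝ → Plane} {C : Set Plane} (hf : IsInjParametrization f C)
    {c : ℕ → List SquareCode} (hc : ∀ n : ℕ, ApproximatesWithin C (1 / ((n : ℝ) + 1)) (c n))
    {a : ℝ} (ha0 : 0 ≤ a) (ha : a < (length f).toReal) :
    ∃ z : Certificate, z.Valid (c z.1.1) ∧ a < (ratOfCode z.2.1 : ℝ) := by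
  obtain ⟨hcont, hinj, rfl⟩ := hf
  obtain ⟨K, hK, hS⟩ := exists_lt_sum_dist_equidistant hcont ha0 ha
  have hK' : (0 : ℝ) < K := Nat.cast_pos.2 hK
  set ℓ : ℕ → ℝ := fun i => dist (f (i / K)) (f ((i + 1 : ℕ) / K))
  set len := ∑ i ∈ Finset.range K, ℓ i with hlen
  obtain ⟨η, hη, hKη⟩ : ∃ η > 0, a < len - K * (2 * η) := by
    refine ⟨(len - a) / (4 * K), div_pos (sub_pos.2 hS) (by positivity), ?_⟩
    have : (K : ℝ) * (2 * ((len - a) / (4 * K))) = (len - a) / 2 := by field_simp; ring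
    rw [this]; linarith
  -- The weight increments. The lower bound costs at most `2 * η` per side, which `hKη` allows. The
  -- margin `η` above pays for all later errors: `η / 4` from rounding times, `4 * ε` from moving to
  -- the centers and `4 * ε` from the radii, where `8 * ε ≤ η / 2`.
  choose ρ hρ1 hρ2 using fun i => exists_rat_btwn (show ℓ i - 2 * η < ℓ i - η by linarith)
  choose w hw using fun j : ℕ => ratOfCode_surjective (∑ i ∈ Finset.range j, ρ i)
  have hwK : a < (ratOfCode (w K) : ℝ) := by
    rw [hw, Rat.cast_sum]
    refine hKη.trans_le ?_
    calc len - K * (2 * η) = ∑ i ∈ Finset.range K, (ℓ i - 2 * η) := by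
          rw [Finset.sum_sub_distrib]; simp [hlen]
      _ ≤ _ := Finset.sum_le_sum fun i _ => (hρ1 i).le
  obtain ⟨δ, hδ, hunif⟩ := Metric.uniformContinuousOn_iff.1
    (isCompact_Icc.uniformContinuousOn_of_continuous hcont) (η / 8) (by positivity)
  obtain ⟨R, hR, hRδ⟩ : ∃ R : ℕ, 0 < R ∧ 1 / ((R : ℝ) * K) < δ := by
    obtain ⟨R, hR⟩ := exists_nat_one_div_lt hδ
    refine ⟨R + 1, R.succ_pos, lt_of_le_of_lt ?_ hR⟩
    push_cast
    refine one_div_le_one_div_of_le (by positivity) (le_mul_of_one_le_right (by positivity) ?_)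
    exact_mod_cast hK
  have hR' : (0 : ℝ) < R := Nat.cast_pos.2 hR
  set M : ℝ := (R : ℝ) * K with hM
  have hM0 : 0 < M := by positivity
  -- With labels rounded to the grid of mesh `1 / M`, times whose labels differ by at least 2 are
  -- more than `1 / M` apart. Times with a label other than that of an endpoint are only guaranteed
  -- to be `1 / (2 * M)` away from that endpoint, which determines `σ`.
  obtain ⟨κ, hκ, hsep⟩ := exists_pos_le_dist_of_injOn hcont hinj
    (σ := 1 / (2 * M)) (by positivity)
  obtain ⟨ε, hε, hεη, hεκ⟩ : ∃ ε > 0, 16 * ε ≤ η ∧ 16 * ε ≤ κ :=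
    ⟨min η κ / 16, by positivity, by linarith [min_le_left η κ], by linarith [min_le_right η κ]⟩
  obtain ⟨δ', hδ', hsmall⟩ := exists_pos_forall_square_not_near
    (isCompact_Icc.image_of_continuousOn hcont) (interior_arc_eq_empty hcont hinj) hε
  -- Below `δ'` the squares of the cover have radius less than `ε`; below `ε` the anchoring squares
  -- and the distances from centers to the curve are at the same scale.
  obtain ⟨n, hn⟩ := exists_nat_one_div_lt (lt_min hδ' hε)
  have hnδ : 1 / ((n : ℝ) + 1) < δ' := hn.trans_le (min_le_left _ _)
  have hnε : 1 / ((n : ℝ) + 1) < ε := hn.trans_le (min_le_right _ _)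
  obtain ⟨hcov, hnear⟩ := hc n
  have hrad : ∀ d ∈ c n, SquareCode.radius d < ε := by
    intro d hd
    by_contra! h
    refine hsmall d.center fun q hq => ?_
    obtain ⟨p, hp, hqp⟩ := hnear d hd q ⟨hq.1.trans_le h, hq.2.trans_le h⟩
    exact ⟨p, hp, hqp.1.trans hnδ, hqp.2.trans hnδ⟩
  have htime : ∀ d : SquareCode, ∃ t ∈ Icc (0 : ℝ) 1, d ∈ c n → ¬ ratOfCode d.2.2 ≤ 0 →
      dist d.center (f t) ≤ 2 * ε := by
    intro d
    by_cases h : d ∈ c n ∧ ¬ ratOfCode d.2.2 ≤ 0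
    · obtain ⟨_, ⟨t, ht, rfl⟩, hdt⟩ := hnear d h.1 d.center
        (self_mem_nbhd ((SquareCode.radius_pos_iff d).2 h.2) _)
      exact ⟨t, ht, fun _ _ => (dist_lt_of_mem_nbhd hdt).le.trans (by linarith)⟩
    · exact ⟨0, by simp, fun h1 h2 => absurd ⟨h1, h2⟩ h⟩
  choose T hTI hT using htime
  -- The integer nearest to `T d * M`; it is off by at most `1 / 2` and lies between `0` and `R *
  -- K`.
  set lab : SquareCode → ℕ := fun d => ⌊T d * M + 1 / 2⌋₊
  have hlab1 : ∀ d, (lab d : ℝ) ≤ T d * M + 1 / 2 := fun d =>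
    Nat.floor_le (by have := mul_nonneg (hTI d).1 hM0.le; linarith)
  have hlab2 : ∀ d, T d * M + 1 / 2 < lab d + 1 := fun d => Nat.lt_floor_add_one _
  have hlab3 : ∀ d, lab d ≤ R * K := by
    intro d
    have h1 : T d * M ≤ M := mul_le_of_le_one_left hM0.le (hTI d).2
    have h2 : (lab d : ℝ) < (R * K : ℕ) + 1 := by push_cast; linarith [hlab1 d]
    exact Nat.lt_succ_iff.1 (by exact_mod_cast h2)
  have hσ : ∀ x : ℝ, 1 / 2 ≤ x * M → 1 / (2 * M) ≤ x := by
    intro x hx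
    rw [div_le_iff₀ (by positivity)]
    linarith
  -- Empty squares are dropped, since they need not be near the curve. The weight depends on the
  -- label only, and only its values at multiples of `R` are ever tested.
  let L : List Link := ((c n).filter fun d => decide (¬ ratOfCode d.2.2 ≤ 0)).map
    fun d => (lab d, w (lab d / R), d)
  have hL : ∀ x ∈ L, ∃ d ∈ c n, ¬ ratOfCode d.2.2 ≤ 0 ∧ (lab d, w (lab d / R), d) = x := by
    intro x hx
    obtain ⟨d, hd, rfl⟩ := List.mem_map.1 hx
    obtain ⟨hd1, hd2⟩ := List.mem_filter.1 hd
    exact ⟨d, hd1, of_decide_eq_true hd2, rfl⟩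
  -- A cover square containing `f t` serves as anchor: squares with a label other than `l` belong to
  -- times far from `t`, so `κ` separates them from it.
  have hanchor : ∀ (t : ℝ) (l : ℕ), t ∈ Icc (0 : ℝ) 1 →
      (∀ d, lab d ≠ l → 1 / (2 * M) ≤ |t - T d|) → Anchored (c n) n l L := by
    intro t l ht hl
    obtain ⟨d, hd, htd⟩ := hcov (f t) (mem_image_of_mem f ht)
    refine ⟨d, hd, (SquareCode.radius_pos_iff d).1 (nbhd_nonempty_pos htd), fun x hx => ?_⟩
    obtain ⟨d', hd', hpos', rfl⟩ := hL x hx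
    refine or_iff_not_imp_left.2 fun hne => ?_
    refine apart_of_le_dist (ε := ε) (p := f t) (q := f (T d')) ?_ (hrad d' hd').le ?_
      (hT d' hd' hpos') (hεκ.trans (hsep t ht _ (hTI d') (hl d' hne))) hε.le
    · rw [radius_mk_one]; exact hnε.le
    · have h1 := dist_lt_of_mem_nbhd htd
      rw [dist_comm] at h1
      exact h1.le.trans (by linarith [hrad d hd])
  refine ⟨((n, R, K), w K, L), ⟨?_, ?_, ?_, ?_, ?_, ?_⟩, hwK⟩
  · intro d hd
    refine or_iff_not_imp_left.2 fun hpos => ⟨_, List.mem_map.2 ⟨d, ?_, rfl⟩, rfl⟩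
    exact List.mem_filter.2 ⟨hd, decide_eq_true hpos⟩
  · intro x hx y hy
    obtain ⟨d, hd, hpos, rfl⟩ := hL x hx
    obtain ⟨d', hd', hpos', rfl⟩ := hL y hy
    refine or_iff_not_imp_left.2 fun h => ?_
    have h' : (lab d : ℝ) + 2 ≤ lab d' := by exact_mod_cast not_not.1 h
    refine apart_of_le_dist (hrad d hd).le (hrad d' hd').le (hT d hd hpos) (hT d' hd' hpos')
      (hεκ.trans (hsep _ (hTI d) _ (hTI d') ?_)) hε.le
    rw [abs_sub_comm]
    refine (hσ _ ?_).trans (le_abs_self _)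
    linarith [hlab1 d', hlab2 d]
  · intro x hx y hy
    obtain ⟨d, hd, hpos, rfl⟩ := hL x hx
    obtain ⟨d', hd', hpos', rfl⟩ := hL y hy
    refine or_iff_not_imp_left.2 fun h1 => or_iff_not_imp_left.2 fun h2 => ?_
    simp only [not_not] at h1 h2
    obtain ⟨j, hj⟩ := Nat.dvd_of_mod_eq_zero h1
    have hj' : lab d' = R * (j + 1) := by rw [h2, hj]; ring
    have hjK : j + 1 ≤ K := Nat.le_of_mul_le_mul_left (hj' ▸ hlab3 d') hR
    have hclose : ∀ (e : SquareCode) (i : ℕ), lab e = R * i → i ≤ K →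
        dist (f (T e)) (f (i / K)) < η / 8 := by
      intro e i hi hiK
      refine hunif _ (hTI e) _ ⟨by positivity, (div_le_one hK').2 (by exact_mod_cast hiK)⟩ ?_
      refine lt_of_le_of_lt ?_ hRδ
      have h1 := hlab1 e
      have h2 := hlab2 e
      have h3 : (lab e : ℝ) = (i / K) * M := by rw [hi, hM]; push_cast; field_simp
      rw [h3] at h1 h2
      rw [Real.dist_eq, le_div_iff₀ hM0, ← abs_of_pos hM0, ← abs_mul, sub_mul]
      exact abs_le.2 ⟨by linarith, by linarith⟩
    have hc1 := hclose d j hj (by omega)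
    have hc2 := hclose d' (j + 1) hj' hjK
    have hd1 := hT d hd hpos
    have hd2 := hT d' hd' hpos'
    have hr1 := hrad d hd
    have hr2 := hrad d' hd'
    rw [weightsSpaced_iff, linkGap_cast]
    simp only [hj, hj', Nat.mul_div_cancel_left _ hR, hw, Finset.sum_range_succ, Rat.cast_add]
    have hρ := hρ2 j
    have t1 : ℓ j ≤ dist (f (j / K)) (f (T d)) + dist (f (T d)) (f (T d')) +
        dist (f (T d')) (f ((j + 1 : ℕ) / K)) := dist_triangle4 _ _ _ _
    have t2 := dist_triangle4 (f (T d)) d.center d'.center (f (T d'))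
    rw [dist_comm _ (f (T d))] at t1
    rw [dist_comm (f (T d)) d.center] at t2
    linarith
  · refine hanchor 0 0 (by simp) fun d hd => ?_
    have h1 : (1 : ℝ) ≤ lab d := by exact_mod_cast Nat.one_le_iff_ne_zero.2 hd
    rw [abs_sub_comm]
    refine (hσ _ ?_).trans (le_abs_self _)
    linarith [hlab1 d]
  · refine hanchor 1 (R * K) (by simp) fun d hd => ?_
    have h1 : (lab d : ℝ) + 1 ≤ (R * K : ℕ) := by
      exact_mod_cast lt_of_le_of_ne (hlab3 d) hd
    push_cast at h1
    refine (hσ _ ?_).trans (le_abs_self _)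
    linarith [hlab2 d]
  · intro x hx y hy
    obtain ⟨d, hd, hpos, rfl⟩ := hL x hx
    obtain ⟨d', hd', hpos', rfl⟩ := hL y hy
    refine or_iff_not_imp_left.2 fun h1 => or_iff_not_imp_left.2 fun h2 => ?_
    simp only [not_not] at h1 h2
    simp only [h1, h2, Nat.mul_div_cancel_left _ hR, hw, Nat.zero_div, Finset.sum_range_zero,
      sub_zero, le_refl]

end CompCurve

theorem theorem2p2 (C : Set CompCurve.Plane) (f : ℝ → CompCurve.Plane)
    (hf : CompCurve.IsInjParametrization f C) (hrect : CompCurve.length f < ⊤)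
    (hK : CompCurve.IsKComputable C) :
    CompCurve.IsLeftComputable (CompCurve.length f).toReal := by
  have hC : IsCompact C := hf.2.2 ▸ isCompact_Icc.image_of_continuousOn hf.1
  have hC0 : C.Nonempty := hf.2.2 ▸ (Set.nonempty_Icc.2 zero_le_one).image f
  obtain ⟨c, hc, happ⟩ := hK.exists_approximatesWithin hC.isBounded hC0
  exact CompCurve.isLeftComputable_of_certificates hc ENNReal.toReal_nonneg
    (fun z hz => hz.le_length hf hrect (happ _))
    (fun a ha ha0 => CompCurve.exists_valid_certificate hf happ ha0 ha)
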